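/- **Theorem (Convergence of empirical loss to expected loss).** There are $N$ agents with finite behaviour space $\mathbb{B}$ and finite feedback space $\mathbb{H}$; $\mathbb{U}$ is a measurable space of random user factors with a probability distribution, and $\eta=(\eta_1,\dots,\eta_N):\mathbb{U}\times\mathbb{B}^N\to\mathbb{H}^N$ is a feedback function, measurable in its first variable. Agent $i$ has transition probabilities $P_i(q\mid p;h)$, $p,q\in\mathbb{B}$, $h\in\mathbb{H}$; for a joint feedback $k\in\mathbb{H}^N$ let $M_k$ be the matrix on $\mathbb{B}^N$ with entries $M_k(m,n)=\prod_{i=1}^N P_i(n_i\mid m_i;k_i)$. The users $u_1,u_2,\dots$ are i.i.d. with the given distribution, $u_t$ is independent of $(b_1,\dots,b_t,u_1,\dots,u_{t-1})$, the feedback is $h_t=\eta(u_t,b_t)$, and the joint behaviours $b_t\in\mathbb{B}^N$ satisfy $$P(b_{t+1}=n\mid b_1,\dots,b_t;u_1,\dots,u_t)=M_{h_t}(b_t,n)\qquad(t\ge1,\ n\in\mathbb{B}^N),$$ the law of $b_1$ being arbitrary. Assume * (A.1) for every $k\in\mathbb{H}^N$ the matrix $M_k$ is irreducible and aperiodic;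 * (A.2) $P(u\in\mathbb{U}:\eta(u,m)=k)>0$ for all $m\in\mathbb{B}^N$, $k\in\mathbb{H}^N$. Let $z_t=(h_t,b_t,b_{t+1})$ be the lifted chain. Its state space is the set of the triples $(k,m,n)\in\mathbb{H}^N\times\mathbb{B}^{2N}$ with $M_k(m,n)>0$ (the other triples are never visited and are erased), $Z$ is the number of its states, and its transition matrix $M$ has the entry $P(u:\eta(u,m)=k)\,M_k(m,n)$ from $(j,p,q)$ to $(k,m,n)$ if $m=q$, and $0$ if $m\ne q$. Then $M$ has a unique stationary distribution $\pi$, and there is an $N_0\ge1$ such that all entries of $M^{N_0}$ are positive. Moreover, let $N_0\ge 1$ be any integer such that all entries of $M^{N_0}$ are positive, let $\delta>0$ be the minimum entry of $M^{N_0}$, let $f:\mathbb{H}^N\times\mathbb{B}^N\to\mathbb{B}^N$ be a predictor, and let $l:\mathbb{B}^N\times\mathbb{B}^N\to\mathbb{R}$ be a loss function with $|l|\le B$, where $B>0$. Put $$err_S^T(f)=\frac1T\sum_{t=1}^T l\bigl(f(h_t,b_t),b_{t+1}\bigr),\qquad err_\pi(f)=\sum_{(k,m,n)}\pi(k,m,n)\,l\bigl(f(k,m),n\bigr).$$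 Then for every $\epsilon>0$ and every integer $T>2BN_0/(Z\delta\epsilon)$, $$P\bigl(|err_S^T(f)-err_\pi(f)|\ge\epsilon\bigr)\le 2\exp\left(-\frac{Z^2\delta^2\bigl(T\epsilon-2BN_0/(Z\delta)\bigr)^2}{2TB^2N_0^2}\right).$$ -/

import Mathlib

open MeasureTheory ProbabilityTheory

/-- The data of a system of `N` agents: user space `𝕌`, behaviour space `𝔹` and feedback space `ℍ`
of a single agent. -/
structure AgentSystem (N : ℕ) (𝕌 𝔹 ℍ : Type*) [MeasurableSpace 𝕌] [MeasurableSpace ℍ]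
    [Fintype 𝔹] [DecidableEq 𝔹] where
  /-- `feedback i u m` is the feedback `η_i(u, m)` of agent `i` when the users are `u` and the joint
  behaviour is `m`. -/
  feedback : Fin N → 𝕌 → (Fin N → 𝔹) → ℍ
  measurable_feedback : ∀ i m, Measurable fun x => feedback i x m
  /-- The common distribution of the random users. -/
  userLaw : Measure 𝕌
  isProbabilityMeasure_userLaw : IsProbabilityMeasure userLaw
  /-- `trans i k p q` is the probability that agent `i` passes from behaviour `p` to behaviour `q`
  after receiving feedback `k`. -/
  trans : Fin N → ℍ → Matrix 𝔹 𝔹 ℝ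
  trans_mem : ∀ i k, trans i k ∈ Matrix.rowStochastic ℝ 𝔹

namespace AgentSystem

variable {N : ℕ} {𝕌 𝔹 ℍ : Type*} [MeasurableSpace 𝕌] [MeasurableSpace ℍ]
  [Fintype 𝔹] [DecidableEq 𝔹] (A : AgentSystem N 𝕌 𝔹 ℍ)

/-- The joint feedback `η(u, m)`. -/
def jointFeedback (x : 𝕌) (m : Fin N → 𝔹) : Fin N → ℍ := fun i => A.feedback i x m

/-- The transition matrix `M_k` of the joint behaviour under the joint feedback `k`:
given the feedback, the agents move independently. -/
def jointMatrix (k : Fin N → ℍ) : Matrix (Fin N → 𝔹) (Fin N → 𝔹) ℝ :=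
  Matrix.of fun m n => ∏ i, A.trans i (k i) (m i) (n i)

/-- The probability `P(u : η(u, m) = k)`. -/
noncomputable def feedbackProb (m : Fin N → 𝔹) (k : Fin N → ℍ) : ℝ :=
  A.userLaw.real {x | A.jointFeedback x m = k}

/-- The states `(k, m, n)` of the lifted chain `(h_t, b_t, b_{t+1})`: the triples of `ℍ^N × 𝔹^{2N}`
with `M_k(m, n) > 0`, triples with `M_k(m, n) = 0` being erased. -/
def State : Type _ :=
  {s : (Fin N → ℍ) × (Fin N → 𝔹) × (Fin N → 𝔹) // 0 < A.jointMatrix s.1 s.2.1 s.2.2}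

noncomputable instance [Fintype ℍ] : Fintype A.State :=
  haveI : Finite A.State := Subtype.finite
  Fintype.ofFinite _

noncomputable instance : DecidableEq A.State := Classical.decEq _

/-- The one-step transition matrix `M` of the lifted chain: from `(j, p, q)` to `(k, m, n)` it is
`P(u : η(u, m) = k) * M_k(m, n)` if `m = q`, and `0` otherwise. -/
noncomputable def liftedMatrix : Matrix A.State A.State ℝ :=
  Matrix.of fun r s =>
    if s.1.2.1 = r.1.2.2 then
      A.feedbackProb s.1.2.1 s.1.1 * A.jointMatrix s.1.1 s.1.2.1 s.1.2.2
    else 0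

/-- What is known when the users of round `t` arrive:
`b_1, …, b_t` and `u_1, …, u_{t-1}`. -/
abbrev pastBeforeUser {Ω : Type*} [MeasurableSpace 𝔹] (u : ℕ → Ω → 𝕌) (b : ℕ → Ω → Fin N → 𝔹)
    (t : ℕ) : MeasurableSpace Ω :=
  (⨆ s ∈ Finset.Icc 1 t, MeasurableSpace.comap (b s) inferInstance) ⊔
    ⨆ s ∈ Finset.Ico 1 t, MeasurableSpace.comap (u s) inferInstance

/-- What is known after the users of round `t` have arrived:
`b_1, …, b_t` and `u_1, …, u_t`. -/
abbrev past {Ω : Type*} [MeasurableSpace 𝔹] (u : ℕ → Ω → 𝕌) (b : ℕ → Ω → Fin N → 𝔹)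
    (t : ℕ) : MeasurableSpace Ω :=
  (⨆ s ∈ Finset.Icc 1 t, MeasurableSpace.comap (b s) inferInstance) ⊔
    ⨆ s ∈ Finset.Icc 1 t, MeasurableSpace.comap (u s) inferInstance

/-- `(u_t, b_t)`, `t ≥ 1`, is a run of the system: a Markov chain in the random environment
`h_t = η(u_t, b_t)`. The conditions `law_user` and `indep_user` say that the `u_t` are i.i.d. and
that `u_t` is independent of the behaviours and users that precede it. The law of `b_1` is arbitrary; `u 0` and `b 0` play
no role. -/
structure IsRun {Ω : Type*} [MeasurableSpace Ω] [MeasurableSpace 𝔹] (P : Measure Ω)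
    (u : ℕ → Ω → 𝕌) (b : ℕ → Ω → Fin N → 𝔹) : Prop where
  measurable_user : ∀ t, 1 ≤ t → Measurable (u t)
  measurable_behavior : ∀ t, 1 ≤ t → Measurable (b t)
  law_user : ∀ t, 1 ≤ t → P.map (u t) = A.userLaw
  indep_user : ∀ t, 1 ≤ t →
    Indep (MeasurableSpace.comap (u t) inferInstance) (pastBeforeUser u b t) P
  /-- `P(b_{t+1} = n | b_1, …, b_t; u_1, …, u_t) = M_{h_t}(b_t, n)`. -/
  condExp_behavior : ∀ t, 1 ≤ t → ∀ n : Fin N → 𝔹,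
    P[(b (t + 1) ⁻¹' {n}).indicator (fun _ => (1 : ℝ)) | past u b t] =ᵐ[P]
      fun ω => A.jointMatrix (A.jointFeedback (u t ω) (b t ω)) (b t ω) n

/-- The empirical risk `err_S^T(f)` of the predictor `f` on the sample `z_1, …, z_T`,
`z_t = (h_t, b_t, b_{t+1})`. -/
noncomputable def empiricalRisk {Ω : Type*} (u : ℕ → Ω → 𝕌) (b : ℕ → Ω → Fin N → 𝔹)
    (l : (Fin N → 𝔹) → (Fin N → 𝔹) → ℝ) (f : (Fin N → ℍ) × (Fin N → 𝔹) → (Fin N → 𝔹))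
    (T : ℕ) (ω : Ω) : ℝ :=
  (1 / (T : ℝ)) * ∑ t ∈ Finset.Icc 1 T,
    l (f (A.jointFeedback (u t ω) (b t ω), b t ω)) (b (t + 1) ω)

/-- The expected risk `err_π(f)`. -/
noncomputable def expectedRisk [Fintype ℍ] (π : A.State → ℝ)
    (l : (Fin N → 𝔹) → (Fin N → 𝔹) → ℝ) (f : (Fin N → ℍ) × (Fin N → 𝔹) → (Fin N → 𝔹)) : ℝ :=
  ∑ s : A.State, π s * l (f (s.1.1, s.1.2.1)) s.1.2.2

end AgentSystem

/-- Every state `i` has period one: the greatest common divisor of all `d ≥ 1` with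
`(M ^ d) i i > 0` is `1`. -/
def Matrix.IsAperiodicChain {S : Type*} [Fintype S] [DecidableEq S] (M : Matrix S S ℝ) : Prop :=
  ∀ i, ∀ g : ℕ, (∀ d, 1 ≤ d → 0 < (M ^ d) i i → g ∣ d) → g = 1

/-- `π` is a stationary distribution of the transition matrix `M`. -/
def Matrix.IsStationaryDistribution {S : Type*} [Fintype S] (M : Matrix S S ℝ) (π : S → ℝ) : Prop :=
  π ∈ stdSimplex ℝ S ∧ Matrix.vecMul π M = π

/-- The minimum entry of a matrix with a nonempty finite index type. -/
noncomputable def Matrix.minEntry {S : Type*} (M : Matrix S S ℝ) : ℝ :=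
  ⨅ p : S × S, M p.1 p.2

/-!
As every feedback has positive probability, the behaviour matrix averaged over the feedback,
`Q(m, n) = ∑ₖ P(u : η(u, m) = k) Mₖ(m, n)`, is positive wherever a single `Mₖ` is, and an
irreducible aperiodic `Mₖ` is primitive; hence `Q` is primitive. The powers of the lifted matrix `M`
are expressed by those of `Q` (`AgentSystem.liftedMatrix_pow_succ_apply`), so that `M` is primitive
as well.

Once `M ^ N₀ ≥ δ` entrywise, Doeblin's argument applies: with `Z` states, `M ^ N₀` contracts vectors
of total mass zero and oscillations of functions by the factor `1 - Z δ`. The first contraction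
gives the unique stationary distribution `π`. The second gives a solution `g` of the Poisson
equation `g - M g = F - π F`, where `F` is the loss as a function of the state; its oscillation is
at most `R = 2 B N₀ / (Z δ)` (`Matrix.exists_poisson_solution`).

Along the lifted chain `X` the sum `∑ (F (X t) - π F)` is the martingale with differences
`g (X (t + 1)) - (M g) (X t)`, up to a boundary term bounded by `R`. Conditionally on the past each
difference ranges over an interval of length `R`, so Hoeffding's lemma and the Chernoff bound yield
`exp (-2 (T ε - R)² / (T R²))` for either sign (`IsMarkovChain.measureReal_le_abs_sum_le`), which is
the claimed bound.

That the triples of a run form a Markov chain (`AgentSystem.IsRun.isMarkovChain`) is the tower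
property: condition first on the past together with the present users, then on the past alone.
-/

/-! ### Primitive matrices -/

namespace Matrix

variable {S : Type*} [Fintype S] [DecidableEq S]

theorem pow_add_apply_pos {M : Matrix S S ℝ} (hM : ∀ i j, 0 ≤ M i j) {a b : ℕ} {i j k : S}
    (ha : 0 < (M ^ a) i j) (hb : 0 < (M ^ b) j k) : 0 < (M ^ (a + b)) i k := by
  rw [pow_add, mul_apply]
  exact Finset.sum_pos'
    (fun x _ => mul_nonneg (pow_apply_nonneg hM a i x) (pow_apply_nonneg hM b x k))
    ⟨j, Finset.mem_univ j, mul_pos ha hb⟩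

/-- The return times of `i` form an additive semigroup whose greatest common divisor is one, so
that they exhaust all large integers. -/
theorem IsAperiodicChain.eventually_pow_apply_self_pos {M : Matrix S S ℝ} (hM : ∀ i j, 0 ≤ M i j)
    (hap : M.IsAperiodicChain) (i : S) : ∃ n₀, ∀ n ≥ n₀, 0 < (M ^ n) i i := by
  obtain ⟨n₀, hn₀⟩ := Nat.exists_mem_closure_of_ge {d : ℕ | 1 ≤ d ∧ 0 < (M ^ d) i i}
  have hg : Nat.setGcd {d : ℕ | 1 ≤ d ∧ 0 < (M ^ d) i i} = 1 :=
    hap i _ fun d h1 h2 => Nat.setGcd_dvd_of_mem ⟨h1, h2⟩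
  refine ⟨n₀, fun n hn => ?_⟩
  have hmem := hn₀ n hn (by simp [hg])
  clear hn
  induction hmem using AddSubmonoid.closure_induction with
  | mem x hx => exact hx.2
  | zero => simp
  | add x y _ _ hx hy => exact pow_add_apply_pos hM hx hy

theorem IsIrreducible.isPrimitive_of_isAperiodicChain {M : Matrix S S ℝ} (hirr : M.IsIrreducible)
    (hap : M.IsAperiodicChain) : M.IsPrimitive := by
  refine ⟨hirr.nonneg, ?_⟩
  choose n₀ hn₀ using hap.eventually_pow_apply_self_pos hirr.nonneg
  choose p _ hp using (isIrreducible_iff_exists_pow_pos hirr.nonneg).1 hirr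
  refine ⟨∑ i, n₀ i + ∑ i, ∑ j, p i j + 1, by omega, fun i j => ?_⟩
  have h1 : n₀ i ≤ ∑ i, n₀ i := Finset.single_le_sum (fun _ _ => Nat.zero_le _) (Finset.mem_univ i)
  have h2 : p i j ≤ ∑ i, ∑ j, p i j :=
    (Finset.single_le_sum (f := fun j => p i j) (fun _ _ => Nat.zero_le _)
      (Finset.mem_univ j)).trans (Finset.single_le_sum (f := fun i => ∑ j, p i j)
        (fun _ _ => Nat.zero_le _) (Finset.mem_univ i))
  have h3 : ∑ i, n₀ i + ∑ i, ∑ j, p i j + 1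
      = (∑ i, n₀ i + ∑ i, ∑ j, p i j + 1 - p i j) + p i j := by omega
  rw [h3]
  exact pow_add_apply_pos hirr.nonneg (hn₀ i _ (by omega)) (hp i j)

/-- Positivity of an entry of a power depends only on the pattern of positive entries. -/
theorem pow_apply_pos_of_support_subset {M M' : Matrix S S ℝ} (hM : ∀ i j, 0 ≤ M i j)
    (hM' : ∀ i j, 0 ≤ M' i j) (h : ∀ i j, 0 < M i j → 0 < M' i j) :
    ∀ (n : ℕ) (i j : S), 0 < (M ^ n) i j → 0 < (M' ^ n) i j
  | 0, i, j, hn => by simpa using hn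
  | n + 1, i, j, hn => by
    rw [pow_succ, mul_apply] at hn
    obtain ⟨x, -, hx⟩ := (Finset.sum_pos_iff_of_nonneg fun x _ =>
      mul_nonneg (pow_apply_nonneg hM n i x) (hM x j)).1 hn
    have h1 := pos_of_mul_pos_left hx (hM x j)
    have h2 := pos_of_mul_pos_right hx (pow_apply_nonneg hM n i x)
    refine pow_add_apply_pos hM' (pow_apply_pos_of_support_subset hM hM' h n i x h1) (b := 1) ?_
    simpa using h x j h2

/-! ### Stationary distributions and the Poisson equation -/

section Doeblin

variable {M : Matrix S S ℝ} {δ : ℝ}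

theorem sum_sub_const_of_mem_rowStochastic (hM : M ∈ rowStochastic ℝ S) (δ : ℝ) (r : S) :
    ∑ s, (M r s - δ) = 1 - Fintype.card S * δ := by
  simp [Finset.sum_sub_distrib, sum_row_of_mem_rowStochastic hM]

/-- **Doeblin contraction** for measures: subtracting the constant `δ` from all entries does not
change the action on vectors of total mass zero. -/
theorem sum_abs_vecMul_le (hM : M ∈ rowStochastic ℝ S) (hδ : ∀ r s, δ ≤ M r s) {v : S → ℝ}
    (hv : ∑ r, v r = 0) :
    ∑ s, |(v ᵥ* M) s| ≤ (1 - Fintype.card S * δ) * ∑ r, |v r| := by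
  calc ∑ s, |(v ᵥ* M) s| = ∑ s, |∑ r, v r * (M r s - δ)| := by
        refine Finset.sum_congr rfl fun s _ => ?_
        simp [vecMul, dotProduct, mul_sub, Finset.sum_sub_distrib, ← Finset.sum_mul, hv]
    _ ≤ ∑ s, ∑ r, |v r| * (M r s - δ) := by
        refine Finset.sum_le_sum fun s _ => (Finset.abs_sum_le_sum_abs _ _).trans_eq ?_
        refine Finset.sum_congr rfl fun r _ => ?_
        rw [abs_mul, abs_of_nonneg (sub_nonneg.2 (hδ r s))]
    _ = _ := by
        rw [Finset.sum_comm, Finset.mul_sum]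
        refine Finset.sum_congr rfl fun r _ => ?_
        rw [← Finset.mul_sum, sum_sub_const_of_mem_rowStochastic hM, mul_comm]

/-- **Doeblin contraction** for functions: a stochastic matrix with entries at least `δ` shrinks
oscillations by the factor `1 - |S| δ`. -/
theorem mulVec_sub_mulVec_le (hM : M ∈ rowStochastic ℝ S) (hδ : ∀ r s, δ ≤ M r s) {h : S → ℝ}
    {R : ℝ} (hR : ∀ r s, h r - h s ≤ R) (r s : S) :
    (M *ᵥ h) r - (M *ᵥ h) s ≤ (1 - Fintype.card S * δ) * R := by
  have : Nonempty S := ⟨r⟩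
  obtain ⟨a, ha⟩ := Finite.exists_min h
  have key : ∀ r, (M *ᵥ h) r = ∑ t, (M r t - δ) * h t + δ * ∑ t, h t := fun r => by
    simp [mulVec, dotProduct, sub_mul, Finset.sum_sub_distrib, Finset.mul_sum]
  have h1 : ∑ t, (M r t - δ) * h t ≤ (1 - Fintype.card S * δ) * (h a + R) := by
    rw [← sum_sub_const_of_mem_rowStochastic hM δ r, Finset.sum_mul]
    refine Finset.sum_le_sum fun t _ => mul_le_mul_of_nonneg_left ?_ (sub_nonneg.2 (hδ r t))
    linarith [hR t a]
  have h2 : (1 - Fintype.card S * δ) * h a ≤ ∑ t, (M s t - δ) * h t := by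
    rw [← sum_sub_const_of_mem_rowStochastic hM δ s, Finset.sum_mul]
    exact Finset.sum_le_sum fun t _ => mul_le_mul_of_nonneg_left (ha t) (sub_nonneg.2 (hδ s t))
  rw [key r, key s]
  linarith

theorem vecMul_pow_eq_self {v : S → ℝ} (hv : v ᵥ* M = v) (n : ℕ) : v ᵥ* M ^ n = v := by
  induction n with
  | zero => simp
  | succ n ih => rw [pow_succ, ← vecMul_vecMul, ih, hv]

theorem mulVec_pow_eq_self {v : S → ℝ} (hv : M *ᵥ v = v) (n : ℕ) : M ^ n *ᵥ v = v := by
  induction n with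
  | zero => simp
  | succ n ih => rw [pow_succ, ← mulVec_mulVec, hv, ih]

variable {N₀ : ℕ}

theorem eq_zero_of_vecMul_eq_self_of_sum_eq_zero [Nonempty S] (hM : M ∈ rowStochastic ℝ S)
    (hδ₀ : 0 < δ) (hδ : ∀ r s, δ ≤ (M ^ N₀) r s) {v : S → ℝ} (hv : v ᵥ* M = v)
    (hv0 : ∑ r, v r = 0) : v = 0 := by
  have h := sum_abs_vecMul_le (pow_mem hM N₀) hδ hv0
  rw [vecMul_pow_eq_self hv] at h
  have hc : 0 < (Fintype.card S : ℝ) * δ := by positivity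
  have h0 : 0 ≤ ∑ r, |v r| := Finset.sum_nonneg fun _ _ => abs_nonneg _
  have h1 : ∑ r, |v r| = 0 := by nlinarith
  funext r
  simpa using (Finset.sum_eq_zero_iff_of_nonneg fun _ _ => abs_nonneg _).1 h1 r (Finset.mem_univ r)

theorem sum_vecMul_of_mem_rowStochastic (hM : M ∈ rowStochastic ℝ S) (v : S → ℝ) :
    ∑ s, (v ᵥ* M) s = ∑ r, v r := by
  simp only [vecMul, dotProduct]
  rw [Finset.sum_comm]
  simp [← Finset.mul_sum, sum_row_of_mem_rowStochastic hM]

/-- A left fixed vector `v` exists because `M - 1` annihilates the constants; comparing total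
masses shows that `|v|` is a left fixed vector too, and normalizing it gives a stationary
distribution. -/
theorem existsUnique_isStationaryDistribution [Nonempty S] (hM : M ∈ rowStochastic ℝ S)
    (hδ₀ : 0 < δ) (hδ : ∀ r s, δ ≤ (M ^ N₀) r s) :
    ∃! π : S → ℝ, M.IsStationaryDistribution π := by
  have hdet : (M - 1).det = 0 := by
    refine exists_mulVec_eq_zero_iff.1 ⟨1, one_ne_zero, ?_⟩
    rw [sub_mulVec, one_mulVec, one_vecMul_of_mem_rowStochastic hM, sub_self]
  obtain ⟨v, hv0, hv⟩ := exists_vecMul_eq_zero_iff.2 hdet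
  rw [vecMul_sub, vecMul_one, sub_eq_zero] at hv
  have hle : ∀ s, |v s| ≤ ((fun r => |v r|) ᵥ* M) s := fun s => by
    conv_lhs => rw [← hv]
    refine (Finset.abs_sum_le_sum_abs _ _).trans_eq ?_
    refine Finset.sum_congr rfl fun r _ => ?_
    rw [abs_mul, abs_of_nonneg (nonneg_of_mem_rowStochastic hM)]
  have habs : (fun r => |v r|) ᵥ* M = fun r => |v r| := by
    funext s
    exact ((Finset.sum_eq_sum_iff_of_le fun s _ => hle s).1
      (sum_vecMul_of_mem_rowStochastic hM _).symm s (Finset.mem_univ s)).symm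
  have hpos : 0 < ∑ r, |v r| := by
    obtain ⟨r, hr⟩ := Function.ne_iff.1 hv0
    exact Finset.sum_pos' (fun _ _ => abs_nonneg _) ⟨r, Finset.mem_univ r, abs_pos.2 hr⟩
  refine ⟨(∑ r, |v r|)⁻¹ • fun r => |v r|, ⟨⟨fun r => ?_, ?_⟩, ?_⟩, fun π hπ => ?_⟩
  · simp only [Pi.smul_apply, smul_eq_mul]
    positivity
  · simp only [Pi.smul_apply, smul_eq_mul, ← Finset.mul_sum]
    exact inv_mul_cancel₀ hpos.ne'
  · rw [smul_vecMul, habs]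
  · rw [← sub_eq_zero]
    refine eq_zero_of_vecMul_eq_self_of_sum_eq_zero hM hδ₀ hδ ?_ ?_
    · rw [sub_vecMul, hπ.2, smul_vecMul, habs]
    · simp only [Pi.sub_apply, Pi.smul_apply, smul_eq_mul, Finset.sum_sub_distrib,
        ← Finset.mul_sum, inv_mul_cancel₀ hpos.ne', hπ.1.2, sub_self]

theorem apply_eq_of_mulVec_eq_self (hM : M ∈ rowStochastic ℝ S)
    (hδ₀ : 0 < δ) (hδ : ∀ r s, δ ≤ (M ^ N₀) r s) {h : S → ℝ} (hh : M *ᵥ h = h) (r s : S) :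
    h r = h s := by
  have : Nonempty S := ⟨r⟩
  obtain ⟨p, hp⟩ := Finite.exists_max fun p : S × S => h p.1 - h p.2
  have h1 := mulVec_sub_mulVec_le (pow_mem hM N₀) hδ (fun r s => hp (r, s)) p.1 p.2
  rw [mulVec_pow_eq_self hh] at h1
  have hc : 0 < (Fintype.card S : ℝ) * δ := by positivity
  have h2 : h p.1 - h p.2 ≤ 0 := by nlinarith
  have h3 := hp (r, s)
  have h4 := hp (s, r)
  simp only at h3 h4
  linarith

/-- A solution `g` of the **Poisson equation** `g - M g = f - π f`. It exists because
`1 - M + 1 ⊗ π` is injective, and its oscillation is controlled by iterating the equation `N₀` times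
and contracting with `M ^ N₀`. -/
theorem exists_poisson_solution (hM : M ∈ rowStochastic ℝ S) (hδ₀ : 0 < δ)
    (hδ : ∀ r s, δ ≤ (M ^ N₀) r s) {π : S → ℝ} (hπ : M.IsStationaryDistribution π)
    {f : S → ℝ} {B : ℝ} (hf : ∀ s, |f s| ≤ B) :
    ∃ g : S → ℝ, (∀ s, g s = f s - π ⬝ᵥ f + (M *ᵥ g) s) ∧
      ∀ r s, g r - g s ≤ 2 * B * N₀ / (Fintype.card S * δ) := by
  -- `K = 1 - M + 1 ⊗ π` preserves the mean `π`, which makes its kernel trivial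
  set K : Matrix S S ℝ := 1 - M + Matrix.of fun _ s => π s with hK
  have hKv : ∀ (v : S → ℝ) (s : S), (K *ᵥ v) s = v s - (M *ᵥ v) s + π ⬝ᵥ v := fun v s => by
    rw [hK, add_mulVec, sub_mulVec, one_mulVec]
    rfl
  have hπK : ∀ v : S → ℝ, π ⬝ᵥ (K *ᵥ v) = π ⬝ᵥ v := fun v => by
    have h1 : K *ᵥ v = v - M *ᵥ v + fun _ => π ⬝ᵥ v := funext fun s => hKv v s
    have h2 : (π ⬝ᵥ fun _ : S => π ⬝ᵥ v) = π ⬝ᵥ v := by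
      conv_lhs => rw [dotProduct, ← Finset.sum_mul, hπ.1.2, one_mul]
    rw [h1, dotProduct_add, dotProduct_sub, dotProduct_mulVec, hπ.2, sub_self, zero_add, h2]
  have hinj : Function.Injective K.mulVec := by
    refine (injective_iff_map_eq_zero K.mulVecLin).2 fun v hv => ?_
    rw [mulVecLin_apply] at hv
    have h0 : π ⬝ᵥ v = 0 := by rw [← hπK v, hv, dotProduct_zero]
    have hfix : M *ᵥ v = v := funext fun s => by
      have := hKv v s
      rw [hv, h0, Pi.zero_apply] at this
      linarith
    funext s
    have hconst : v = fun _ => v s :=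
      funext fun r => apply_eq_of_mulVec_eq_self hM hδ₀ hδ hfix r s
    rw [hconst, dotProduct, ← Finset.sum_mul, hπ.1.2, one_mul] at h0
    exact h0
  obtain ⟨g, hg⟩ := mulVec_surjective_iff_isUnit.2 (mulVec_injective_iff_isUnit.1 hinj)
    (fun s => f s - π ⬝ᵥ f)
  have hπg : π ⬝ᵥ g = 0 := by
    rw [← hπK g, hg]
    simp only [dotProduct, mul_sub, Finset.sum_sub_distrib, ← Finset.sum_mul, hπ.1.2]
    ring
  have hgs : ∀ s, g s = f s - π ⬝ᵥ f + (M *ᵥ g) s := fun s => by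
    have := hKv g s
    rw [hg, hπg] at this
    linarith
  refine ⟨g, hgs, fun r s => ?_⟩
  have : Nonempty S := ⟨r⟩
  have hfbar : ∀ (i : ℕ) (r s : S), (M ^ i *ᵥ fun s => f s - π ⬝ᵥ f) r
      - (M ^ i *ᵥ fun s => f s - π ⬝ᵥ f) s ≤ 2 * B := fun i r s => by
    have := mulVec_sub_mulVec_le (pow_mem hM i) (δ := 0)
      (fun r s => nonneg_of_mem_rowStochastic (pow_mem hM i))
      (h := fun s => f s - π ⬝ᵥ f) (R := 2 * B)
      (fun r s => by linarith [abs_le.1 (hf r), abs_le.1 (hf s)]) r s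
    simpa using this
  have hiter : ∀ n : ℕ,
      g = ∑ i ∈ Finset.range n, M ^ i *ᵥ (fun s => f s - π ⬝ᵥ f) + M ^ n *ᵥ g := by
    intro n
    induction n with
    | zero => simp
    | succ n ih =>
      have hg1 : g = (fun s => f s - π ⬝ᵥ f) + M *ᵥ g := funext hgs
      rw [Finset.sum_range_succ, pow_succ, ← mulVec_mulVec, add_assoc, ← mulVec_add, ← hg1]
      exact ih
  -- the oscillation of `g`, attained at `p`, bounds itself through the contraction
  obtain ⟨p, hp⟩ := Finite.exists_max fun p : S × S => g p.1 - g p.2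
  have hmain : g p.1 - g p.2 ≤ 2 * B * N₀ + (1 - Fintype.card S * δ) * (g p.1 - g p.2) := by
    have h1 := mulVec_sub_mulVec_le (pow_mem hM N₀) hδ (fun r s => hp (r, s)) p.1 p.2
    have h2 : ∑ i ∈ Finset.range N₀, ((M ^ i *ᵥ fun s => f s - π ⬝ᵥ f) p.1
      - (M ^ i *ᵥ fun s => f s - π ⬝ᵥ f) p.2) ≤ 2 * B * N₀ := by
      refine (Finset.sum_le_sum fun i _ => hfbar i p.1 p.2).trans_eq ?_
      simp [mul_comm]
    rw [Finset.sum_sub_distrib] at h2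
    have e1 := congrFun (hiter N₀) p.1
    have e2 := congrFun (hiter N₀) p.2
    simp only [Pi.add_apply, Finset.sum_apply] at e1 e2
    linarith
  have hc : 0 < (Fintype.card S : ℝ) * δ := by positivity
  refine (hp (r, s)).trans ?_
  rw [le_div_iff₀ hc]
  linarith

end Doeblin

end Matrix

/-! ### Hoeffding's inequality for finite Markov chains -/

section MarkovHoeffding

/-- **Hoeffding's lemma** for a probability vector on a finite type. -/
theorem sum_mul_exp_sub_le_of_mem_stdSimplex {S : Type*} [Fintype S] {p : S → ℝ}
    (hp : p ∈ stdSimplex ℝ S) {g : S → ℝ} {R : ℝ} (hg : ∀ r s, g r - g s ≤ R) (θ : ℝ) :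
    ∑ s, p s * Real.exp (θ * (g s - p ⬝ᵥ g)) ≤ Real.exp (R ^ 2 * θ ^ 2 / 8) := by
  have hne : Nonempty S := by
    by_contra h
    rw [not_nonempty_iff] at h
    simpa using hp.2
  let : MeasurableSpace S := ⊤
  set μ : Measure S := ∑ s, ENNReal.ofReal (p s) • Measure.dirac s with hμ
  have hint : ∀ F : S → ℝ, ∫ s, F s ∂μ = ∑ s, p s * F s := fun F => by
    rw [hμ, integral_finsetSum_measure fun s _ =>
      (integrable_dirac (by simp)).smul_measure (by simp)]
    refine Finset.sum_congr rfl fun s _ => ?_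
    rw [integral_smul_measure, integral_dirac, ENNReal.toReal_ofReal (hp.1 s), smul_eq_mul]
  have hprob : IsProbabilityMeasure μ := ⟨by
    simp [hμ, ← ENNReal.ofReal_sum_of_nonneg fun s _ => hp.1 s, hp.2]⟩
  obtain ⟨a, ha⟩ := Finite.exists_min g
  have hR : 0 ≤ R := by simpa using hg a a
  have h := (hasSubgaussianMGF_of_mem_Icc_of_integral_eq_zero (μ := μ)
    (X := fun s => g s - p ⬝ᵥ g) (a := g a - p ⬝ᵥ g) (b := g a - p ⬝ᵥ g + R)
    (measurable_from_top.aemeasurable)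
    (ae_of_all _ fun s => ⟨by linarith [ha s], by linarith [hg s a]⟩) (by
      rw [hint]
      simp only [mul_sub, Finset.sum_sub_distrib, ← Finset.sum_mul, hp.2, one_mul]
      exact sub_self _)).mgf_le θ
  rw [mgf, hint] at h
  refine h.trans_eq ?_
  congr 1
  simp only [add_sub_cancel_left, NNReal.coe_pow, NNReal.coe_div, coe_nnnorm, Real.norm_eq_abs,
    abs_of_nonneg hR, NNReal.coe_ofNat]
  ring

variable {Ω S : Type*} {mΩ : MeasurableSpace Ω} {P : Measure Ω} [MeasurableSpace S]

/-- `X` is a Markov chain with transition matrix `M` relative to the filtration `𝒢`. -/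
structure IsMarkovChain (P : Measure Ω) (𝒢 : Filtration ℕ mΩ) (X : ℕ → Ω → S) (M : Matrix S S ℝ) :
    Prop where
  measurable : ∀ t, Measurable[𝒢 t] (X t)
  condExp_indicator : ∀ t s,
    P[(X (t + 1) ⁻¹' {s}).indicator (fun _ => (1 : ℝ)) | 𝒢 t] =ᵐ[P] fun ω => M (X t ω) s

namespace IsMarkovChain

variable {𝒢 : Filtration ℕ mΩ} {X : ℕ → Ω → S} {M : Matrix S S ℝ}

theorem measurable' (h : IsMarkovChain P 𝒢 X M) (t : ℕ) : Measurable (X t) :=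
  (h.measurable t).mono (𝒢.le t) le_rfl

variable [Fintype S] [DiscreteMeasurableSpace S]

theorem integrable_mul_comp (h : IsMarkovChain P 𝒢 X M) (t : ℕ) {W : Ω → ℝ}
    (hW : Integrable W P) (Φ : S → S → ℝ) :
    Integrable (fun ω => W ω * Φ (X t ω) (X (t + 1) ω)) P := by
  obtain ⟨c, hc⟩ := (Set.finite_range fun p : S × S => ‖Φ p.1 p.2‖).bddAbove
  refine hW.mul_bdd (c := c) ?_ (ae_of_all _ fun ω => hc ⟨(X t ω, X (t + 1) ω), rfl⟩)
  exact ((measurable_of_finite fun p : S × S => Φ p.1 p.2).comp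
    ((h.measurable' t).prodMk (h.measurable' (t + 1)))).aestronglyMeasurable

variable [IsProbabilityMeasure P]

/-- The Markov property, with a weight `W` known at time `t`. -/
theorem integral_mul_comp (h : IsMarkovChain P 𝒢 X M) (t : ℕ) {W : Ω → ℝ}
    (hWm : StronglyMeasurable[𝒢 t] W) (hW : Integrable W P) (Φ : S → S → ℝ) :
    ∫ ω, W ω * Φ (X t ω) (X (t + 1) ω) ∂P
      = ∫ ω, W ω * ∑ s, M (X t ω) s * Φ (X t ω) s ∂P := by
  classical
  have hsplit : ∀ ω, W ω * Φ (X t ω) (X (t + 1) ω) = ∑ s, W ω * Φ (X t ω) s *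
      (X (t + 1) ⁻¹' {s}).indicator (fun _ => (1 : ℝ)) ω := fun ω => by
    rw [Finset.sum_eq_single (X (t + 1) ω)]
    · simp
    · intro s _ hs
      simp [Set.indicator_of_notMem, hs.symm]
    · simp
  have hind : ∀ s, Integrable ((X (t + 1) ⁻¹' {s}).indicator (fun _ => (1 : ℝ))) P := fun s =>
    (integrable_const 1).indicator (h.measurable' (t + 1) (MeasurableSet.singleton s))
  have hΦ : ∀ s, StronglyMeasurable[𝒢 t] fun ω => W ω * Φ (X t ω) s := fun s =>
    hWm.mul ((measurable_of_finite fun r => Φ r s).comp (h.measurable t)).stronglyMeasurable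
  have hprod : ∀ s, Integrable (fun ω => W ω * Φ (X t ω) s *
      (X (t + 1) ⁻¹' {s}).indicator (fun _ => (1 : ℝ)) ω) P := fun s => by
    refine (h.integrable_mul_comp t hW fun r s' => Φ r s * if s' = s then 1 else 0).congr
      (ae_of_all _ fun ω => ?_)
    by_cases hs : X (t + 1) ω = s <;> simp [hs]
  simp only [hsplit, Finset.mul_sum]
  rw [integral_finsetSum _ fun s _ => hprod s, integral_finsetSum]
  · refine Finset.sum_congr rfl fun s _ => ?_
    rw [← integral_condExp (𝒢.le t)]
    refine integral_congr_ae ?_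
    filter_upwards [condExp_mul_of_stronglyMeasurable_left (hΦ s) (hprod s) (hind s),
      h.condExp_indicator t s] with ω h1 h2
    refine h1.trans ?_
    rw [Pi.mul_apply, h2]
    ring
  · intro s _
    exact h.integrable_mul_comp t hW fun r _ => M r s * Φ r s

variable [DecidableEq S]

/-- Control of the exponential weight `exp (θ ∑ D_i)` of the martingale with differences
`D_i = g (X_{i+1}) - (M g) (X_i)`. -/
theorem integral_exp_martingale_le (h : IsMarkovChain P 𝒢 X M) (hM : M ∈ Matrix.rowStochastic ℝ S)
    {g : S → ℝ} {R : ℝ} (hg : ∀ r s, g r - g s ≤ R) (θ : ℝ) (T : ℕ) :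
    StronglyMeasurable[𝒢 T] (fun ω => Real.exp (θ *
        ∑ i ∈ Finset.range T, (g (X (i + 1) ω) - (M.mulVec g) (X i ω)))) ∧
    Integrable (fun ω => Real.exp (θ *
        ∑ i ∈ Finset.range T, (g (X (i + 1) ω) - (M.mulVec g) (X i ω)))) P ∧
    ∫ ω, Real.exp (θ * ∑ i ∈ Finset.range T, (g (X (i + 1) ω) - (M.mulVec g) (X i ω))) ∂P
      ≤ Real.exp (T * (R ^ 2 * θ ^ 2 / 8)) := by
  have hrow : ∀ r, ∑ s, M r s * Real.exp (θ * (g s - (M.mulVec g) r))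
      ≤ Real.exp (R ^ 2 * θ ^ 2 / 8) := fun r =>
    sum_mul_exp_sub_le_of_mem_stdSimplex (p := M r)
      ⟨fun s => Matrix.nonneg_of_mem_rowStochastic hM, Matrix.sum_row_of_mem_rowStochastic hM r⟩
      hg θ
  induction T with
  | zero => exact ⟨by simpa using stronglyMeasurable_const, by simp, by simp⟩
  | succ T ih =>
    obtain ⟨hm, hi, hle⟩ := ih
    simp only [Finset.sum_range_succ, mul_add θ, Real.exp_add]
    refine ⟨?_, h.integrable_mul_comp T hi fun r s => Real.exp (θ * (g s - (M.mulVec g) r)), ?_⟩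
    · refine (hm.mono (𝒢.mono T.le_succ)).mul (Measurable.stronglyMeasurable ?_)
      exact (measurable_of_finite fun p : S × S =>
        Real.exp (θ * (g p.2 - (M.mulVec g) p.1))).comp
        (((h.measurable T).mono (𝒢.mono T.le_succ) le_rfl).prodMk (h.measurable (T + 1)))
    · rw [h.integral_mul_comp T hm hi fun r s => Real.exp (θ * (g s - (M.mulVec g) r))]
      calc _ ≤ ∫ ω, Real.exp (θ * ∑ i ∈ Finset.range T,
              (g (X (i + 1) ω) - (M.mulVec g) (X i ω))) * Real.exp (R ^ 2 * θ ^ 2 / 8) ∂P := by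
            refine integral_mono ?_ (hi.mul_const _) fun ω =>
              mul_le_mul_of_nonneg_left (hrow (X T ω)) (Real.exp_nonneg _)
            exact h.integrable_mul_comp T hi fun r _ =>
              ∑ s, M r s * Real.exp (θ * (g s - (M.mulVec g) r))
        _ ≤ Real.exp (T * (R ^ 2 * θ ^ 2 / 8)) * Real.exp (R ^ 2 * θ ^ 2 / 8) := by
            rw [integral_mul_const]
            exact mul_le_mul_of_nonneg_right hle (Real.exp_nonneg _)
        _ = _ := by
            rw [← Real.exp_add]
            push_cast
            ring_nf

/-- One-sided deviation bound from a solution `g` of the Poisson equation with oscillation at most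
`R`: the sum telescopes to a martingale up to a boundary term `g (X_0) - g (X_T) ≤ R`. -/
theorem measureReal_le_sum_le (h : IsMarkovChain P 𝒢 X M) (hM : M ∈ Matrix.rowStochastic ℝ S)
    {g f : S → ℝ} {e R : ℝ} (hR : 0 < R) (hg : ∀ r s, g r - g s ≤ R)
    (hpoi : ∀ s, g s = f s - e + (M.mulVec g) s) {T : ℕ} (hT : 0 < T) {a : ℝ} (ha : R ≤ a) :
    P.real {ω | a ≤ ∑ i ∈ Finset.range T, (f (X i ω) - e)}
      ≤ Real.exp (-(2 * (a - R) ^ 2 / (T * R ^ 2))) := by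
  have hT' : (0 : ℝ) < T := by exact_mod_cast hT
  -- the optimal Chernoff parameter for the sub-Gaussian constant `T R² / 4`
  set θ : ℝ := 4 * (a - R) / (T * R ^ 2) with hθ
  have hθ0 : 0 ≤ θ := div_nonneg (by linarith) (by positivity)
  obtain ⟨-, hi, hle⟩ := h.integral_exp_martingale_le hM hg θ T
  have htel : ∀ ω, ∑ i ∈ Finset.range T, (f (X i ω) - e)
      = ∑ i ∈ Finset.range T, (g (X (i + 1) ω) - (M.mulVec g) (X i ω))
        - (g (X T ω) - g (X 0 ω)) := fun ω => by
    rw [← Finset.sum_range_sub (fun i => g (X i ω)), ← Finset.sum_sub_distrib]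
    refine Finset.sum_congr rfl fun i _ => ?_
    linarith [hpoi (X i ω)]
  calc P.real {ω | a ≤ ∑ i ∈ Finset.range T, (f (X i ω) - e)}
      ≤ P.real {ω | a - R ≤ ∑ i ∈ Finset.range T, (g (X (i + 1) ω) - (M.mulVec g) (X i ω))} := by
        refine measureReal_mono fun ω hω => ?_
        rw [Set.mem_ofPred_eq, htel ω] at hω
        have := hg (X 0 ω) (X T ω)
        simp only [Set.mem_ofPred_eq]
        linarith
    _ ≤ Real.exp (-θ * (a - R)) * Real.exp (T * (R ^ 2 * θ ^ 2 / 8)) :=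
        (measure_ge_le_exp_mul_mgf _ hθ0 hi).trans
          (mul_le_mul_of_nonneg_left hle (Real.exp_nonneg _))
    _ = _ := by
        rw [← Real.exp_add]
        congr 1
        rw [hθ]
        field_simp
        ring

/-- **Hoeffding's inequality for uniformly ergodic chains** (Glynn and Ormoneit), on a finite
state space. -/
theorem measureReal_le_abs_sum_le (h : IsMarkovChain P 𝒢 X M)
    (hM : M ∈ Matrix.rowStochastic ℝ S) {N₀ : ℕ} (hN₀ : 1 ≤ N₀) {δ : ℝ} (hδ₀ : 0 < δ)
    (hδ : ∀ r s, δ ≤ (M ^ N₀) r s) {π : S → ℝ} (hπ : M.IsStationaryDistribution π)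
    {f : S → ℝ} {B : ℝ} (hB : 0 < B) (hf : ∀ s, |f s| ≤ B) {T : ℕ} (hT : 0 < T) {a : ℝ}
    (ha : 2 * B * N₀ / (Fintype.card S * δ) ≤ a) :
    P.real {ω | a ≤ |∑ i ∈ Finset.range T, (f (X i ω) - π ⬝ᵥ f)|}
      ≤ 2 * Real.exp (-(2 * (a - 2 * B * N₀ / (Fintype.card S * δ)) ^ 2
          / (T * (2 * B * N₀ / (Fintype.card S * δ)) ^ 2))) := by
  obtain ⟨ω⟩ : Nonempty Ω := nonempty_of_isProbabilityMeasure P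
  have : Nonempty S := ⟨X 0 ω⟩
  have hR : 0 < 2 * B * N₀ / (Fintype.card S * δ) := by
    have : (0 : ℝ) < N₀ := by exact_mod_cast hN₀
    positivity
  obtain ⟨g, hg1, hg2⟩ := Matrix.exists_poisson_solution hM hδ₀ hδ hπ hf
  have hup := h.measureReal_le_sum_le hM hR hg2 hg1 hT ha
  have hlow := h.measureReal_le_sum_le hM (g := -g) (f := -f) (e := -(π ⬝ᵥ f)) hR
    (fun r s => by simpa [neg_add_eq_sub] using hg2 s r)
    (fun s => by
      rw [Matrix.mulVec_neg]
      simp only [Pi.neg_apply]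
      linarith [hg1 s]) hT ha
  rw [two_mul]
  refine le_trans ?_ (add_le_add hup hlow)
  refine (measureReal_mono ?_).trans (measureReal_union_le _ _)
  intro ω hω
  have hneg : ∑ i ∈ Finset.range T, ((-f) (X i ω) - -(π ⬝ᵥ f))
      = -∑ i ∈ Finset.range T, (f (X i ω) - π ⬝ᵥ f) := by
    rw [← Finset.sum_neg_distrib]
    refine Finset.sum_congr rfl fun i _ => ?_
    simp only [Pi.neg_apply]
    ring
  rcases le_abs.1 (show a ≤ |_| from hω) with h1 | h1
  · exact Or.inl h1
  · exact Or.inr (by simpa only [Set.mem_ofPred_eq, hneg] using h1)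

end IsMarkovChain

end MarkovHoeffding

open scoped Matrix

namespace AgentSystem

/-! ### The filtration of a run -/

section Past

variable {N : ℕ} {𝕌 𝔹 Ω : Type*} [MeasurableSpace 𝕌] [MeasurableSpace 𝔹] {u : ℕ → Ω → 𝕌}
  {b : ℕ → Ω → Fin N → 𝔹}

theorem measurable_behavior_past {s t : ℕ} (h1 : 1 ≤ s) (h2 : s ≤ t) :
    Measurable[pastBeforeUser u b t] (b s) :=
  (comap_measurable (b s)).mono ((le_iSup₂_of_le (f := fun s (_ : s ∈ Finset.Icc 1 t) =>
    MeasurableSpace.comap (b s) inferInstance) s (Finset.mem_Icc.2 ⟨h1, h2⟩) le_rfl).trans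
    le_sup_left) le_rfl

theorem measurable_user_past {s t : ℕ} (h1 : 1 ≤ s) (h2 : s < t) :
    Measurable[pastBeforeUser u b t] (u s) :=
  (comap_measurable (u s)).mono ((le_iSup₂_of_le (f := fun s (_ : s ∈ Finset.Ico 1 t) =>
    MeasurableSpace.comap (u s) inferInstance) s (Finset.mem_Ico.2 ⟨h1, h2⟩) le_rfl).trans
    le_sup_right) le_rfl

theorem pastBeforeUser_le_past (t : ℕ) : pastBeforeUser u b t ≤ past u b t :=
  sup_le_sup_left (biSup_mono fun _ hs => Finset.Ico_subset_Icc_self hs) _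

theorem measurable_user_past' {t : ℕ} (h1 : 1 ≤ t) : Measurable[past u b t] (u t) :=
  (comap_measurable (u t)).mono ((le_iSup₂_of_le (f := fun s (_ : s ∈ Finset.Icc 1 t) =>
    MeasurableSpace.comap (u s) inferInstance) t (Finset.mem_Icc.2 ⟨h1, le_rfl⟩) le_rfl).trans
    le_sup_right) le_rfl

theorem pastBeforeUser_mono : Monotone (pastBeforeUser u b) := fun _ _ h =>
  sup_le_sup (biSup_mono fun _ hs => Finset.Icc_subset_Icc_right h hs)
    (biSup_mono fun _ hs => Finset.Ico_subset_Ico_right h hs)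

end Past

/-! ### The lifted matrix -/

variable {N : ℕ} {𝕌 𝔹 ℍ : Type*} [MeasurableSpace 𝕌] [MeasurableSpace ℍ]
  [Fintype 𝔹] [DecidableEq 𝔹] (A : AgentSystem N 𝕌 𝔹 ℍ)

instance : IsProbabilityMeasure A.userLaw := A.isProbabilityMeasure_userLaw

theorem jointMatrix_mem_rowStochastic (k : Fin N → ℍ) :
    A.jointMatrix k ∈ Matrix.rowStochastic ℝ (Fin N → 𝔹) := by
  refine Matrix.mem_rowStochastic_iff_sum.2 ⟨fun m n => ?_, fun m => ?_⟩
  · change 0 ≤ ∏ i, A.trans i (k i) (m i) (n i)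
    exact Finset.prod_nonneg fun i _ => Matrix.nonneg_of_mem_rowStochastic (A.trans_mem i (k i))
  · have h := Finset.prod_univ_sum (fun _ : Fin N => (Finset.univ : Finset 𝔹))
      fun i q => A.trans i (k i) (m i) q
    simp only [Matrix.sum_row_of_mem_rowStochastic (A.trans_mem _ _), Finset.prod_const_one,
      Fintype.piFinset_univ] at h
    exact h.symm

theorem jointMatrix_nonneg (k : Fin N → ℍ) (m n : Fin N → 𝔹) : 0 ≤ A.jointMatrix k m n :=
  Matrix.nonneg_of_mem_rowStochastic (A.jointMatrix_mem_rowStochastic k)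

theorem measurable_jointFeedback (m : Fin N → 𝔹) : Measurable fun x => A.jointFeedback x m :=
  measurable_pi_lambda _ fun i => A.measurable_feedback i m

variable {A} in
theorem measurable_jointFeedback_comp {Ω : Type*} {m : MeasurableSpace Ω} [MeasurableSpace 𝔹]
    [DiscreteMeasurableSpace 𝔹] {x : Ω → 𝕌} {y : Ω → Fin N → 𝔹}
    (hx : Measurable[m] x) (hy : Measurable[m] y) :
    Measurable[m] fun ω => A.jointFeedback (x ω) (y ω) :=
  (measurable_from_prod_countable_left (f := fun p : 𝕌 × (Fin N → 𝔹) => A.jointFeedback p.1 p.2)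
    A.measurable_jointFeedback).comp (hx.prodMk hy)

theorem exists_state (k : Fin N → ℍ) (m : Fin N → 𝔹) : Nonempty A.State := by
  have h := Matrix.sum_row_of_mem_rowStochastic (A.jointMatrix_mem_rowStochastic k) m
  obtain ⟨n, -, hn⟩ := Finset.exists_ne_zero_of_sum_ne_zero (h.trans_ne one_ne_zero)
  exact ⟨⟨(k, m, n), lt_of_le_of_ne (A.jointMatrix_nonneg k m n) hn.symm⟩⟩

variable {A} in
/-- The underlying triple `(k, m, n)` of a state. -/
def State.toTriple (s : A.State) : (Fin N → ℍ) × (Fin N → 𝔹) × (Fin N → 𝔹) := Subtype.val s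

variable {A} in
theorem State.toTriple_injective : Function.Injective (State.toTriple (A := A)) :=
  Subtype.val_injective

variable {A} in
theorem State.pos (s : A.State) :
    0 < A.jointMatrix s.toTriple.1 s.toTriple.2.1 s.toTriple.2.2 := Subtype.prop s

theorem liftedMatrix_apply (r s : A.State) : A.liftedMatrix r s =
    if s.toTriple.2.1 = r.toTriple.2.2 then A.feedbackProb s.toTriple.2.1 s.toTriple.1 *
      A.jointMatrix s.toTriple.1 s.toTriple.2.1 s.toTriple.2.2 else 0 := rfl

theorem liftedMatrix_nonneg (r s : A.State) : 0 ≤ A.liftedMatrix r s := by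
  rw [liftedMatrix_apply]
  split_ifs
  · exact mul_nonneg measureReal_nonneg s.pos.le
  · exact le_rfl

section Lifted

variable [Fintype ℍ]

theorem sum_feedbackProb [DiscreteMeasurableSpace ℍ] (m : Fin N → 𝔹) :
    ∑ k, A.feedbackProb m k = 1 := by
  have h := sum_measureReal_preimage_singleton (μ := A.userLaw)
    (f := fun x => A.jointFeedback x m) Finset.univ
    (fun k _ => A.measurable_jointFeedback m (MeasurableSet.singleton k))
  simp only [Finset.coe_univ, Set.preimage_univ, probReal_univ] at h
  exact h

/-- Erased triples may be added to a sum over the states when the summand vanishes on them. -/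
theorem sum_state_eq (F : (Fin N → ℍ) → (Fin N → 𝔹) → (Fin N → 𝔹) → ℝ)
    (hF : ∀ k m n, A.jointMatrix k m n = 0 → F k m n = 0) :
    ∑ s : A.State, F s.toTriple.1 s.toTriple.2.1 s.toTriple.2.2 = ∑ k, ∑ m, ∑ n, F k m n := by
  classical
  rw [Fintype.sum_of_injective (State.toTriple (A := A)) State.toTriple_injective
    (fun s : A.State => F s.toTriple.1 s.toTriple.2.1 s.toTriple.2.2)
    (fun p => F p.1 p.2.1 p.2.2) ?_ fun _ => rfl]
  · simp only [Fintype.sum_prod_type]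
  · rintro ⟨k, m, n⟩ hp
    exact hF k m n (le_antisymm (not_lt.1 fun h => hp ⟨⟨(k, m, n), h⟩, rfl⟩)
      (A.jointMatrix_nonneg k m n))

/-- The transition matrix of the joint behaviour, averaged over the feedback. -/
noncomputable def behaviorMatrix : Matrix (Fin N → 𝔹) (Fin N → 𝔹) ℝ :=
  Matrix.of fun m n => ∑ k, A.feedbackProb m k * A.jointMatrix k m n

theorem behaviorMatrix_apply (m n : Fin N → 𝔹) :
    A.behaviorMatrix m n = ∑ k, A.feedbackProb m k * A.jointMatrix k m n := rfl

/-- The last component of the lifted chain moves according to the averaged behaviour matrix. -/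
theorem sum_liftedMatrix_mul (r : A.State) (v : (Fin N → 𝔹) → ℝ) :
    ∑ s, A.liftedMatrix r s * v s.toTriple.2.2
      = ∑ n, A.behaviorMatrix r.toTriple.2.2 n * v n := by
  simp only [liftedMatrix_apply]
  rw [A.sum_state_eq (fun k m n => (if m = r.toTriple.2.2 then
    A.feedbackProb m k * A.jointMatrix k m n else 0) * v n) (fun k m n h => by simp [h])]
  simp only [behaviorMatrix_apply, Finset.sum_mul]
  rw [Finset.sum_comm (s := Finset.univ (α := Fin N → 𝔹))]
  refine Finset.sum_congr rfl fun k _ => ?_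
  rw [Finset.sum_eq_single r.toTriple.2.2 (fun m _ hm => by simp [hm]) (by simp)]
  simp

theorem liftedMatrix_mem_rowStochastic [DiscreteMeasurableSpace ℍ] :
    A.liftedMatrix ∈ Matrix.rowStochastic ℝ A.State := by
  refine Matrix.mem_rowStochastic_iff_sum.2 ⟨A.liftedMatrix_nonneg, fun r => ?_⟩
  have h := A.sum_liftedMatrix_mul r 1
  simp only [Pi.one_apply, mul_one] at h
  rw [h]
  simp only [behaviorMatrix_apply]
  rw [Finset.sum_comm]
  simp only [← Finset.mul_sum, Matrix.sum_row_of_mem_rowStochastic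
    (A.jointMatrix_mem_rowStochastic _), mul_one, A.sum_feedbackProb]

/-- After `n + 1` steps the lifted chain is at `s` when the averaged behaviour has reached the
middle component of `s` in `n` steps and the last step has drawn the feedback and the new behaviour. -/
theorem liftedMatrix_pow_succ_apply (n : ℕ) (r s : A.State) :
    (A.liftedMatrix ^ (n + 1)) r s = (A.behaviorMatrix ^ n) r.toTriple.2.2 s.toTriple.2.1 *
      (A.feedbackProb s.toTriple.2.1 s.toTriple.1 *
        A.jointMatrix s.toTriple.1 s.toTriple.2.1 s.toTriple.2.2) := by
  induction n generalizing r with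
  | zero => simp [liftedMatrix_apply, Matrix.one_apply, eq_comm]
  | succ n ih =>
    rw [pow_succ', Matrix.mul_apply]
    simp only [ih, ← mul_assoc]
    rw [← Finset.sum_mul, ← Finset.sum_mul,
      A.sum_liftedMatrix_mul r fun q => (A.behaviorMatrix ^ n) q s.toTriple.2.1,
      pow_succ' A.behaviorMatrix, Matrix.mul_apply]

/-- Since every feedback has positive probability, the averaged behaviour matrix is positive
wherever `M_k` is, so it inherits primitivity from a single `M_k`; the lifted chain inherits it
from the averaged one. -/
theorem exists_liftedMatrix_pow_pos (k : Fin N → ℍ) (hirr : (A.jointMatrix k).IsIrreducible)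
    (hap : (A.jointMatrix k).IsAperiodicChain) (hpos : ∀ m k, 0 < A.feedbackProb m k) :
    ∃ N₀ : ℕ, 1 ≤ N₀ ∧ ∀ r s, 0 < (A.liftedMatrix ^ N₀) r s := by
  obtain ⟨n, -, hn⟩ := (hirr.isPrimitive_of_isAperiodicChain hap).exists_pos_pow
  have hterm : ∀ m n k, 0 ≤ A.feedbackProb m k * A.jointMatrix k m n := fun m n k =>
    mul_nonneg (hpos m k).le (A.jointMatrix_nonneg k m n)
  refine ⟨n + 1, by omega, fun r s => ?_⟩
  rw [A.liftedMatrix_pow_succ_apply]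
  refine mul_pos ?_ (mul_pos (hpos _ _) s.pos)
  refine Matrix.pow_apply_pos_of_support_subset (A.jointMatrix_nonneg k)
    (fun m n => Finset.sum_nonneg fun k _ => hterm m n k) (fun m n h => ?_) n _ _ (hn _ _)
  exact Finset.sum_pos' (fun k _ => hterm m n k) ⟨k, Finset.mem_univ k, mul_pos (hpos m k) h⟩

end Lifted

/-! ### The lifted chain of a run -/

section Run

/-- States carry the discrete σ-algebra. -/
instance : MeasurableSpace A.State := ⊤

instance : DiscreteMeasurableSpace A.State := ⟨fun _ => trivial⟩

variable {Ω : Type*}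

/-- The triple `(h_t, b_t, b_{t+1})`, erased triples not being excluded. -/
def triple (u : ℕ → Ω → 𝕌) (b : ℕ → Ω → Fin N → 𝔹) (t : ℕ) (ω : Ω) :
    (Fin N → ℍ) × (Fin N → 𝔹) × (Fin N → 𝔹) :=
  (A.jointFeedback (u t ω) (b t ω), b t ω, b (t + 1) ω)

open Classical in
/-- The state given by a triple; an erased triple is sent to the default state `s₀`. -/
noncomputable def toState (s₀ : A.State) (p : (Fin N → ℍ) × (Fin N → 𝔹) × (Fin N → 𝔹)) : A.State :=
  if h : 0 < A.jointMatrix p.1 p.2.1 p.2.2 then ⟨p, h⟩ else s₀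

theorem toTriple_toState {s₀ : A.State} {p : (Fin N → ℍ) × (Fin N → 𝔹) × (Fin N → 𝔹)}
    (h : 0 < A.jointMatrix p.1 p.2.1 p.2.2) : (A.toState s₀ p).toTriple = p := by
  exact congrArg State.toTriple (dif_pos h)

variable {A} [MeasurableSpace 𝔹] {u : ℕ → Ω → 𝕌} {b : ℕ → Ω → Fin N → 𝔹}

theorem measurable_toState_triple [DiscreteMeasurableSpace 𝔹] [Fintype ℍ]
    [DiscreteMeasurableSpace ℍ] (s₀ : A.State) {t : ℕ} (ht : 1 ≤ t) :
    Measurable[pastBeforeUser u b (t + 1)] fun ω => A.toState s₀ (A.triple u b t ω) :=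
  (measurable_of_finite (A.toState s₀)).comp
    ((measurable_jointFeedback_comp (measurable_user_past ht t.lt_succ_self)
      (measurable_behavior_past ht t.le_succ)).prodMk
      ((measurable_behavior_past ht t.le_succ).prodMk
        (measurable_behavior_past (ht.trans t.le_succ) le_rfl)))

variable [MeasurableSpace Ω] {P : Measure Ω}

theorem IsRun.past_le (hrun : A.IsRun P u b) (t : ℕ) : past u b t ≤ ‹MeasurableSpace Ω› :=
  sup_le (iSup₂_le fun s hs => (hrun.measurable_behavior s (Finset.mem_Icc.1 hs).1).comap_le)
    (iSup₂_le fun s hs => (hrun.measurable_user s (Finset.mem_Icc.1 hs).1).comap_le)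

variable [DiscreteMeasurableSpace 𝔹] [Fintype ℍ] [DiscreteMeasurableSpace ℍ]
  [IsProbabilityMeasure P]

/-- Conditioning first on the users of round `t` as well (giving `M_k(m, n)`), then on the past
before they arrive (giving `P(u : η(u, m) = k)`, by independence). -/
theorem IsRun.condExp_triple (hrun : A.IsRun P u b) {t : ℕ} (ht : 1 ≤ t)
    (k : Fin N → ℍ) (m n : Fin N → 𝔹) :
    P[(A.triple u b t ⁻¹' {(k, m, n)}).indicator (fun _ => (1 : ℝ)) | pastBeforeUser u b t]
      =ᵐ[P] (b t ⁻¹' {m}).indicator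
        fun _ => A.feedbackProb m k * A.jointMatrix k m n := by
  have hle := hrun.past_le t
  have hle' := pastBeforeUser_le_past (u := u) (b := b) t
  have hbm : MeasurableSet[pastBeforeUser u b t] (b t ⁻¹' {m}) :=
    measurable_behavior_past ht le_rfl (MeasurableSet.singleton m)
  set U : Set Ω := (fun ω => A.jointFeedback (u t ω) m) ⁻¹' {k} with hU
  have hUc : MeasurableSet[MeasurableSpace.comap (u t) inferInstance] U :=
    ⟨_, A.measurable_jointFeedback m (MeasurableSet.singleton k), rfl⟩
  have hUp : MeasurableSet[past u b t] U := (measurable_user_past' ht).comap_le _ hUc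
  have hEp : MeasurableSet[past u b t] (b t ⁻¹' {m} ∩ U) := (hle' _ hbm).inter hUp
  have hn : MeasurableSet (b (t + 1) ⁻¹' {n}) :=
    hrun.measurable_behavior (t + 1) (by omega) (MeasurableSet.singleton n)
  have hone : ∀ {E : Set Ω}, MeasurableSet E → Integrable (E.indicator fun _ => (1 : ℝ)) P :=
    fun hE => (integrable_const 1).indicator hE
  have hmul : ∀ E F : Set Ω, (E.indicator fun _ => (1 : ℝ)) * (F.indicator fun _ => (1 : ℝ))
      = (E ∩ F).indicator fun _ => (1 : ℝ) := fun E F => by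
    funext ω
    by_cases hE : ω ∈ E <;> by_cases hF : ω ∈ F <;> simp [hE, hF]
  have hset : A.triple u b t ⁻¹' {(k, m, n)} = (b t ⁻¹' {m} ∩ U) ∩ b (t + 1) ⁻¹' {n} := by
    ext ω
    simp only [triple, hU, Set.mem_preimage, Set.mem_singleton_iff, Prod.mk.injEq,
      Set.mem_inter_iff]
    constructor
    · rintro ⟨rfl, rfl, rfl⟩
      simp
    · rintro ⟨⟨rfl, rfl⟩, rfl⟩
      simp
  -- given also the users of round `t`, only the new behaviour is random
  have h1 : P[(A.triple u b t ⁻¹' {(k, m, n)}).indicator (fun _ => (1 : ℝ)) | past u b t]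
      =ᵐ[P] (b t ⁻¹' {m}).indicator (fun _ => A.jointMatrix k m n) *
        U.indicator fun _ => (1 : ℝ) := by
    rw [hset, ← hmul]
    filter_upwards [condExp_mul_of_stronglyMeasurable_left
      (stronglyMeasurable_const.indicator hEp) (by rw [hmul]; exact hone ((hle _ hEp).inter hn))
      (hone hn), hrun.condExp_behavior t ht n] with ω e1 e2
    rw [e1, Pi.mul_apply, e2, Pi.mul_apply]
    by_cases hb : b t ω = m
    · by_cases hk : A.jointFeedback (u t ω) m = k <;> simp [Set.indicator, hb, hU, hk]
    · simp [Set.indicator, hb]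
  have h2 : P[U.indicator (fun _ => (1 : ℝ)) | pastBeforeUser u b t]
      =ᵐ[P] fun _ => A.feedbackProb m k := by
    refine (condExp_indep_eq (hrun.measurable_user t ht).comap_le (hle'.trans hle)
      (stronglyMeasurable_const.indicator hUc) (hrun.indep_user t ht)).trans
        (ae_of_all _ fun _ => ?_)
    change ∫ ω, U.indicator (fun _ => (1 : ℝ)) ω ∂P =
      A.userLaw.real ((A.jointFeedback · m) ⁻¹' {k})
    rw [integral_indicator_const _ (hle _ hUp), smul_eq_mul, mul_one,
      ← hrun.law_user t ht, map_measureReal_apply (hrun.measurable_user t ht)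
        (A.measurable_jointFeedback m (MeasurableSet.singleton k))]
    rfl
  refine (condExp_condExp_of_le hle' hle).symm.trans ((condExp_congr_ae h1).trans ?_)
  have hprod : Integrable ((b t ⁻¹' {m}).indicator (fun _ => A.jointMatrix k m n)
      * U.indicator fun _ => (1 : ℝ)) P :=
    (integrable_condExp (m := past u b t)).congr h1
  filter_upwards [condExp_mul_of_stronglyMeasurable_left
    (stronglyMeasurable_const.indicator hbm) hprod (hone (hle _ hUp)), h2] with ω e1 e2
  rw [e1, Pi.mul_apply, e2]
  by_cases hb : b t ω = m <;> simp [Set.indicator, hb, mul_comm]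

theorem IsRun.jointMatrix_triple_pos (hrun : A.IsRun P u b) {t : ℕ} (ht : 1 ≤ t) :
    ∀ᵐ ω ∂P, 0 < A.jointMatrix (A.triple u b t ω).1 (A.triple u b t ω).2.1
      (A.triple u b t ω).2.2 := by
  have hnull : ∀ p : (Fin N → ℍ) × (Fin N → 𝔹) × (Fin N → 𝔹),
      A.jointMatrix p.1 p.2.1 p.2.2 = 0 → ∀ᵐ ω ∂P, A.triple u b t ω ≠ p := by
    rintro ⟨k, m, n⟩ hp
    have hmeas : MeasurableSet (A.triple u b t ⁻¹' {(k, m, n)}) := by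
      refine Measurable.prodMk ?_ (Measurable.prodMk ?_ ?_) (MeasurableSet.singleton _)
      · exact measurable_jointFeedback_comp (hrun.measurable_user t ht)
          (hrun.measurable_behavior t ht)
      · exact hrun.measurable_behavior t ht
      · exact hrun.measurable_behavior (t + 1) (by omega)
    have h := integral_congr_ae (hrun.condExp_triple ht k m n)
    rw [integral_condExp ((pastBeforeUser_le_past t).trans (hrun.past_le t)),
      integral_indicator_const _ hmeas] at h
    simp only at hp
    simp only [hp, mul_zero, Set.indicator_zero, integral_zero, smul_eq_mul, mul_one] at h
    rw [measureReal_eq_zero_iff] at h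
    exact measure_eq_zero_iff_ae_notMem.1 h
  filter_upwards [ae_all_iff.2 fun p => ae_all_iff.2 (hnull p)] with ω hω
  exact lt_of_le_of_ne (A.jointMatrix_nonneg _ _ _) fun h => hω _ h.symm rfl

/-- Up to a null event, the triples of a run form a Markov chain driven by the lifted matrix. Rounds
start at `1`, so the chain at time `t` is the triple of round `t + 1`, which is known before the
users of round `t + 2` arrive. -/
theorem IsRun.isMarkovChain (hrun : A.IsRun P u b) (s₀ : A.State) :
    IsMarkovChain P
      ⟨fun t => pastBeforeUser u b (t + 2), fun _ _ h => pastBeforeUser_mono (by omega),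
        fun t => (pastBeforeUser_le_past _).trans (hrun.past_le _)⟩
      (fun t ω => A.toState s₀ (A.triple u b (t + 1) ω)) A.liftedMatrix where
  measurable t := measurable_toState_triple s₀ (by omega)
  condExp_indicator t s := by
    have hcongr : ((fun ω => A.toState s₀ (A.triple u b (t + 1 + 1) ω)) ⁻¹'
        {s}).indicator (fun _ => (1 : ℝ)) =ᵐ[P]
        (A.triple u b (t + 2) ⁻¹' {s.toTriple}).indicator fun _ => (1 : ℝ) := by
      filter_upwards [hrun.jointMatrix_triple_pos (t := t + 2) (by omega)] with ω hω
      have : A.toState s₀ (A.triple u b (t + 1 + 1) ω) = s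
          ↔ A.triple u b (t + 2) ω = s.toTriple := by
        rw [← State.toTriple_injective.eq_iff, A.toTriple_toState hω]
      by_cases h : A.triple u b (t + 2) ω = s.toTriple
      · rw [Set.indicator_of_mem (by exact this.2 h), Set.indicator_of_mem (by exact h)]
      · rw [Set.indicator_of_notMem (by exact mt this.1 h), Set.indicator_of_notMem (by exact h)]
    refine (condExp_congr_ae hcongr).trans ?_
    filter_upwards [hrun.condExp_triple (t := t + 2) (by omega) s.toTriple.1
      s.toTriple.2.1 s.toTriple.2.2,
      hrun.jointMatrix_triple_pos (t := t + 1) (by omega)] with ω h1 h2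
    refine h1.trans ?_
    rw [liftedMatrix_apply, A.toTriple_toState h2]
    by_cases hb : b (t + 2) ω = s.toTriple.2.1
    · simp [triple, hb]
    · simp [triple, hb, Ne.symm hb]

end Run

end AgentSystem

/-! ### Concentration of the empirical risk -/

theorem Matrix.minEntry_le {S : Type*} [Finite S] (M : Matrix S S ℝ) (r s : S) :
    M.minEntry ≤ M r s :=
  ciInf_le (Set.finite_range fun p : S × S => M p.1 p.2).bddBelow (r, s)

theorem Matrix.minEntry_pos {S : Type*} [Finite S] [Nonempty S] {M : Matrix S S ℝ}
    (hM : ∀ r s, 0 < M r s) : 0 < M.minEntry := by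
  obtain ⟨p, hp⟩ := exists_eq_ciInf_of_finite (f := fun p : S × S => M p.1 p.2)
  exact (hM p.1 p.2).trans_eq hp

theorem mainTheorem2 {N : ℕ} {𝕌 𝔹 ℍ Ω : Type*}
    [MeasurableSpace 𝕌]
    [Fintype 𝔹] [DecidableEq 𝔹] [MeasurableSpace 𝔹] [DiscreteMeasurableSpace 𝔹]
    [Fintype ℍ] [MeasurableSpace ℍ] [DiscreteMeasurableSpace ℍ]
    [MeasurableSpace Ω] (P : Measure Ω) [IsProbabilityMeasure P]
    (A : AgentSystem N 𝕌 𝔹 ℍ)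
    (hA1 : ∀ k, (A.jointMatrix k).IsIrreducible ∧ (A.jointMatrix k).IsAperiodicChain)
    (hA2 : ∀ m k, 0 < A.feedbackProb m k)
    (u : ℕ → Ω → 𝕌) (b : ℕ → Ω → Fin N → 𝔹) (hrun : A.IsRun P u b)
    (l : (Fin N → 𝔹) → (Fin N → 𝔹) → ℝ) (B : ℝ) (hB : 0 < B) (hl : ∀ x y, |l x y| ≤ B)
    (f : (Fin N → ℍ) × (Fin N → 𝔹) → (Fin N → 𝔹)) :
    (∃! π : A.State → ℝ, A.liftedMatrix.IsStationaryDistribution π) ∧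
    (∃ N₀ : ℕ, 1 ≤ N₀ ∧ ∀ r s, 0 < (A.liftedMatrix ^ N₀) r s) ∧
    ∀ π : A.State → ℝ, A.liftedMatrix.IsStationaryDistribution π →
    ∀ N₀ : ℕ, 1 ≤ N₀ → (∀ r s, 0 < (A.liftedMatrix ^ N₀) r s) →
    ∀ (Z δ : ℝ), Z = Fintype.card A.State → δ = (A.liftedMatrix ^ N₀).minEntry →
    ∀ (ε : ℝ) (T : ℕ), 0 < ε → 2 * B * N₀ / (Z * δ * ε) < T →
      P.real {ω | ε ≤ |A.empiricalRisk u b l f T ω - A.expectedRisk π l f|} ≤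
        2 * Real.exp (-(Z ^ 2 * δ ^ 2 * (T * ε - 2 * B * N₀ / (Z * δ)) ^ 2
          / (2 * T * B ^ 2 * N₀ ^ 2))) := by
  obtain ⟨ω₀⟩ : Nonempty Ω := nonempty_of_isProbabilityMeasure P
  set k₀ : Fin N → ℍ := A.jointFeedback (u 1 ω₀) (b 1 ω₀)
  obtain ⟨s₀⟩ := A.exists_state k₀ (b 1 ω₀)
  have : Nonempty A.State := ⟨s₀⟩
  have hM := A.liftedMatrix_mem_rowStochastic
  obtain ⟨n₀, hn₀, hpos₀⟩ := A.exists_liftedMatrix_pow_pos k₀ (hA1 k₀).1 (hA1 k₀).2 hA2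
  refine ⟨Matrix.existsUnique_isStationaryDistribution hM (Matrix.minEntry_pos hpos₀)
    (Matrix.minEntry_le _), ⟨n₀, hn₀, hpos₀⟩, ?_⟩
  intro π hπ N₀ hN₀ hpos Z δ hZ hδ ε T hε hT
  have hδ₀ : 0 < δ := hδ ▸ Matrix.minEntry_pos hpos
  have hZ₀ : 0 < Z := by rw [hZ]; exact_mod_cast Fintype.card_pos
  have hN₀' : (0 : ℝ) < N₀ := by exact_mod_cast hN₀
  have hT' : (0 : ℝ) < T := lt_trans (by positivity) hT
  have hTε : 2 * B * N₀ / (Z * δ) ≤ T * ε := by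
    rw [← div_div, div_lt_iff₀ hε] at hT
    exact hT.le
  set F : A.State → ℝ := fun s => l (f (s.toTriple.1, s.toTriple.2.1)) s.toTriple.2.2 with hF
  have hmain := (hrun.isMarkovChain s₀).measureReal_le_abs_sum_le hM hN₀ hδ₀
    (hδ ▸ Matrix.minEntry_le _) hπ (f := F) hB (fun s => hl _ _) (T := T)
    (by exact_mod_cast hT') (a := T * ε) (by rw [← hZ]; exact hTε)
  rw [← hZ] at hmain
  -- almost surely no erased triple occurs, and the risks are averages along the lifted chain
  refine (ENNReal.toReal_mono (measure_ne_top _ _) (measure_mono_ae ?_)).trans (hmain.trans_eq ?_)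
  · filter_upwards [ae_all_iff.2 fun t : ℕ => hrun.jointMatrix_triple_pos (t := t + 1) (by omega)]
      with ω hω hmem
    have hFt : ∀ t, F (A.toState s₀ (A.triple u b (t + 1) ω)) =
        l (f (A.jointFeedback (u (t + 1) ω) (b (t + 1) ω), b (t + 1) ω)) (b (t + 2) ω) := by
      intro t
      simp only [hF, A.toTriple_toState (hω t)]
      rfl
    have hsum : ∑ i ∈ Finset.range T, (F (A.toState s₀ (A.triple u b (i + 1) ω)) - π ⬝ᵥ F)
        = T * (A.empiricalRisk u b l f T ω - A.expectedRisk π l f) := by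
      have he : A.expectedRisk π l f = π ⬝ᵥ F := rfl
      rw [he, AgentSystem.empiricalRisk, mul_sub, ← mul_assoc, mul_one_div_cancel hT'.ne', one_mul,
        Finset.sum_sub_distrib, Finset.sum_const, Finset.card_range, nsmul_eq_mul,
        ← Finset.Ico_add_one_right_eq_Icc, Finset.sum_Ico_eq_sum_range, Nat.add_sub_cancel]
      congr 1
      refine Finset.sum_congr rfl fun i _ => ?_
      rw [hFt, add_comm 1 i]
    change T * ε ≤ |∑ i ∈ Finset.range T, (F (A.toState s₀ (A.triple u b (i + 1) ω)) - π ⬝ᵥ F)|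
    rw [hsum, abs_mul, abs_of_pos hT']
    exact mul_le_mul_of_nonneg_left hmem hT'.le
  · congr 3
    field_simp
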